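/- Let $d\ge 1$ and $[d]=\{1,\dots,d\}$. For $\emptyset\ne s\subseteq[d]$ and $x\in[0,1]^d$ write $x_s=(x_j)_{j\in s}$, and let $f_s(x_s)=f(x_s,0_{-s})$ be the $s$-section of a function $f:[0,1]^d\to\mathbb R$. A function $f:[0,1]^d\to\mathbb R$ is càdlàg if at every $x$ it has a limit along each quadrant $\{y: y_j<x_j\ (j\in t),\ y_j\ge x_j\ (j\notin t)\}$, $t\subseteq[d]$, that accumulates at $x$ within the cube, and its limit along $\{y: y\ge x\}$ is $f(x)$. For a half-open box $(a,b]=\prod_{j\in s}(a_j,b_j]\subseteq(0_s,1_s]$ let $f_s((a,b])$ be the alternating sum $\sum_{t\subseteq s}(-1)^{|t|}f_s(a_t,b_{s\setminus t})$, and let $\int|f_s(dx_s)|\in[0,\infty]$ be the total variation of the set function $f_s(dx_s)$ so generated, i.e. the supremum of $\sum_k|f_s((a^k,b^k])|$ over finite families of pairwise disjoint half-open boxes. The sectional variation (Hardy–Krause) norm of $f$ is $$\|f\|_v=|f(0)|+\sum_{\emptyset\ne s\subseteq[d]}\int|f_s(dx_s)|.$$ Proposition. Let $f:[0,1]^d\to\mathbb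 R$ be càdlàg with $\|f\|_v\le M$ for some real $M\ge0$. Then there exist weights $\alpha=(\alpha_{s,i}:\emptyset\ne s\subseteq[d],\ i=1,2)$ in the standard simplex of $\mathbb R^{2^{d+1}-2}$ (i.e. $\alpha_{s,i}\ge0$ and $\sum_{s,i}\alpha_{s,i}=1$) and, for all $\emptyset\ne s\subseteq[d]$ and $i=1,2$, a cumulative distribution function $g_{s,i}$ of a probability measure $g_{s,i}(dx_s)$ on the hypercube $[0_s,1_s]$, concentrated on $(0_s,1_s]=\prod_{j\in s}(0,1]$, such that for all $x\in[0,1]^d$ $$f(x)=f(0)+(M-|f(0)|)\sum_{\emptyset\ne s\subseteq[d]}\int_{(0_s,x_s]}\bigl(\alpha_{s,1}\,g_{s,1}(du_s)-\alpha_{s,2}\,g_{s,2}(du_s)\bigr),$$ equivalently $$f(x)=f(0)+(M-|f(0)|)\sum_{\emptyset\ne s\subseteq[d]}\bigl(\alpha_{s,1}\,g_{s,1}(x_s)-\alpha_{s,2}\,g_{s,2}(x_s)\bigr).$$ -/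

import Mathlib

open Set Filter Topology MeasureTheory
open scoped ENNReal

noncomputable section

namespace SectionalVariation

/-- The cube `[0,1]^κ`, with the product order, topology and (Borel) measurable space. -/
abbrev Cube (κ : Type) : Type := κ → unitInterval

/-- The nonempty subsets `s` of `[d]`. -/
abbrev NonemptySubset (d : ℕ) : Type := {s : Finset (Fin d) // s.Nonempty}

/-- A real function on `[0,1]^d` is càdlàg if at each point `x` it has a limit along each of the
`2^d` quadrants given by a choice of `y j < x j` (for `j ∈ t`) or `x j ≤ y j` (for `j ∉ t`), and
if its limit along the quadrant `x ≤ y` is its value at `x`. A quadrant that does not meet the cube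
imposes no condition. -/
def IsCadlag {d : ℕ} (f : Cube (Fin d) → ℝ) : Prop :=
  ∀ x : Cube (Fin d),
    ContinuousWithinAt f (Ici x) x ∧
    ∀ t : Finset (Fin d), ∃ l : ℝ,
      Tendsto f (𝓝[{y | ∀ j, (j ∈ t → y j < x j) ∧ (j ∉ t → x j ≤ y j)}] x) (𝓝 l)

/-- The point `(y_s, 0_{-s})` of `[0,1]^d`. -/
def extendZero {d : ℕ} (s : Finset (Fin d)) (y : Cube s) : Cube (Fin d) :=
  fun j => if h : j ∈ s then y ⟨j, h⟩ else 0

/-- The section `f_s : y_s ↦ f (y_s, 0_{-s})`. -/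
def sect {d : ℕ} (f : Cube (Fin d) → ℝ) (s : Finset (Fin d)) : Cube s → ℝ :=
  fun y => f (extendZero s y)

/-- The half-open box `(a, b] = ∏ j, (a j, b j]`. -/
def box {κ : Type} (a b : Cube κ) : Set (Cube κ) :=
  univ.pi fun j => Ioc (a j) (b j)

/-- The mass `g((a, b])` that the set function `g(dx)` generated by `g` gives to the box `(a, b]`:
the alternating sum of the values of `g` at the vertices of the box (the coordinates in `t` are
taken from `a`, the others from `b`). -/
def boxMass {κ : Type} [Fintype κ] [DecidableEq κ] (g : Cube κ → ℝ) (a b : Cube κ) : ℝ :=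
  ∑ t : Finset κ, (-1 : ℝ) ^ t.card * g (t.piecewise a b)

/-- The total variation `∫ |g(dx)|`, possibly infinite, of the set function `g(dx)`: the supremum
of `∑ |g((a, b])|` over all finite families of pairwise disjoint half-open boxes of the cube. -/
def totalVar {κ : Type} [Fintype κ] [DecidableEq κ] (g : Cube κ → ℝ) : ℝ≥0∞ :=
  ⨆ (F : Finset (Cube κ × Cube κ)) (_ : ∀ p ∈ F, p.1 ≤ p.2)
    (_ : (F : Set (Cube κ × Cube κ)).PairwiseDisjoint fun p => box p.1 p.2),
    ∑ p ∈ F, ENNReal.ofReal |boxMass g p.1 p.2|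

/-- The sectional variation (Hardy--Krause) norm
`‖f‖_v = |f(0)| + ∑_{∅ ≠ s ⊆ [d]} ∫ |f_s(dx_s)|`, with values in `[0, ∞]`. -/
def sectionalVariationNorm {d : ℕ} (f : Cube (Fin d) → ℝ) : ℝ≥0∞ :=
  ENNReal.ofReal |f 0| + ∑ s : NonemptySubset d, totalVar (sect f s.1)

/-- `G` is a cumulative distribution function on the cube, and `P` is the probability measure
`G(dx)` that it generates. -/
def IsCDFOf {κ : Type} (P : Measure (Cube κ)) (G : Cube κ → ℝ) : Prop :=
  IsProbabilityMeasure P ∧ ∀ y, G y = P.real (Iic y)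

end SectionalVariation

end

/-! Möbius inversion over subsets writes `f x - f 0` as the sum over nonempty `s` of the mass that
the section `f_s` gives to `(0_s, x_s]` (`eq_add_sum_boxMass_sect`). It remains to write each such
mass as a difference of two distribution functions, without exceeding the total variation
(`exists_jordan_decomposition`).

On a finite grid this is elementary: place the positive and the negative part of each cell mass at
the upper corner of the cell. The two discrete measures have total mass at most `totalVar`, and by
telescoping their distribution functions differ by exactly `boxMass g 0 y` at grid points `y`. As
the grids grow, compactness of bounded sets of finite measures on the cube gives weak limits `μ` and
`ν`. The identity survives at points whose coordinates are 1 or carry no marginal atom, and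
right-continuity extends it to all points (`exists_measure_Iic_sub`). Mass that ends up on the faces
through 0 is the same for `μ` and `ν`, so it can be discarded.

Finally, a common slack mass is added to both measures of one section, making the overall mass
exactly `M - |f 0|`; normalizing then yields the weights and the probability measures. -/

noncomputable section

namespace SectionalVariation

/-! ### Discrete Jordan decomposition on a finite grid -/

section Grid

variable {κ : Type} [Fintype κ] [DecidableEq κ]

/-- The largest point of the grid `D` that lies strictly below `u`, or `0` if there is none. -/
def predIn (D : Finset unitInterval) (u : unitInterval) : unitInterval :=
  (D.filter (· < u)).sup id

lemma predIn_le (D : Finset unitInterval) (u : unitInterval) : predIn D u ≤ u :=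
  Finset.sup_le fun _ hv => (Finset.mem_filter.1 hv).2.le

lemma predIn_lt (D : Finset unitInterval) {u : unitInterval} (hu : 0 < u) : predIn D u < u :=
  (Finset.sup_lt_iff hu).2 fun _ hv => (Finset.mem_filter.1 hv).2

lemma le_predIn {D : Finset unitInterval} {u v : unitInterval} (hv : v ∈ D) (huv : v < u) :
    v ≤ predIn D u :=
  Finset.le_sup (f := id) (Finset.mem_filter.2 ⟨hv, huv⟩)

@[simp] lemma predIn_zero (D : Finset unitInterval) : predIn D 0 = 0 :=
  le_antisymm (predIn_le D 0) unitInterval.nonneg'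

lemma predIn_mem {D : Finset unitInterval} (hD : 0 ∈ D) (u : unitInterval) : predIn D u ∈ D := by
  rcases eq_or_lt_of_le (unitInterval.nonneg' : (0 : unitInterval) ≤ u) with rfl | hu
  · simpa using hD
  · obtain ⟨v, hv, h⟩ := Finset.exists_mem_eq_sup (D.filter (· < u))
      ⟨0, Finset.mem_filter.2 ⟨hD, hu⟩⟩ id
    rw [predIn, h]
    exact (Finset.mem_filter.1 hv).1

/-- A telescoping sum: peel off the top grid point and continue from its predecessor. The term at 0
vanishes because 0 is its own predecessor. -/
lemma sum_sub_predIn {D : Finset unitInterval} (hD : 0 ∈ D) (h : unitInterval → ℝ)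
    {u : unitInterval} (hu : u ∈ D) :
    ∑ b ∈ D.filter (· ≤ u), (h b - h (predIn D b)) = h u - h 0 := by
  induction hn : (D.filter (· ≤ u)).card using Nat.strong_induction_on generalizing u with
  | _ n ih =>
    rcases eq_or_lt_of_le (unitInterval.nonneg' : (0 : unitInterval) ≤ u) with rfl | hu0
    · have : D.filter (· ≤ (0 : unitInterval)) = {0} := by
        ext b
        simp only [Finset.mem_filter, Finset.mem_singleton]
        exact ⟨fun hb => le_antisymm hb.2 unitInterval.nonneg', fun hb => by simp [hb, hD]⟩
      rw [this, Finset.sum_singleton, predIn_zero]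
    · have hlt := predIn_lt D hu0
      have hins : D.filter (· ≤ u) = insert u (D.filter (· ≤ predIn D u)) := by
        ext b
        simp only [Finset.mem_filter, Finset.mem_insert]
        refine ⟨fun hb => ?_, ?_⟩
        · rcases eq_or_lt_of_le hb.2 with h | h
          · exact Or.inl h
          · exact Or.inr ⟨hb.1, le_predIn hb.1 h⟩
        · rintro (rfl | hb)
          · exact ⟨hu, le_rfl⟩
          · exact ⟨hb.1, hb.2.trans hlt.le⟩
      have hnot : u ∉ D.filter (· ≤ predIn D u) := by simp [hlt]
      rw [hins, Finset.sum_insert hnot,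
        ih _ (by rw [← hn, hins, Finset.card_insert_of_notMem hnot]; exact Nat.lt_succ_self _)
          (predIn_mem hD u) rfl]
      ring

/-- The mass of a box, as a sum over grid points of products of one-dimensional differences. -/
lemma boxMass_eq_sum_grid (g : Cube κ → ℝ) {D : Finset unitInterval} {a b : Cube κ}
    (ha : ∀ j, a j ∈ D) (hb : ∀ j, b j ∈ D) :
    boxMass g a b = ∑ x ∈ Fintype.piFinset fun _ => D,
      (∏ j, ((if x j = b j then (1 : ℝ) else 0) - if x j = a j then 1 else 0)) * g x := by
  -- Expanding the product chooses `a` on `t` and `b` elsewhere, so each term is the indicator of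
  -- one vertex of the box.
  have key (x : Cube κ) (t : Finset κ) :
      (∏ j ∈ Finset.univ \ t, if x j = b j then (1 : ℝ) else 0) *
        (∏ j ∈ t, if x j = a j then (1 : ℝ) else 0) = if x = t.piecewise a b then 1 else 0 := by
    simp only [Finset.prod_ite_zero, Finset.prod_const_one, ite_zero_mul_ite_zero, mul_one]
    refine ite_congr (propext ⟨fun h => funext fun j => ?_, fun h => ?_⟩)
      (fun _ => rfl) fun _ => rfl
    · by_cases hj : j ∈ t
      · simp [hj, h.2 j hj]
      · simp [hj, h.1 j (by simpa using hj)]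
    · subst h
      exact ⟨fun j hj => by simp_all, fun j hj => by simp_all⟩
  simp_rw [Finset.prod_sub, mul_assoc, key, Finset.sum_mul]
  rw [Finset.sum_comm, boxMass, Finset.powerset_univ]
  refine Finset.sum_congr rfl fun t _ => ?_
  rw [Finset.sum_eq_single (t.piecewise a b)]
  · simp
  · intro x _ hx
    simp [hx]
  · intro h
    refine absurd (Fintype.mem_piFinset.2 fun j => ?_) h
    by_cases hj : j ∈ t <;> simp [hj, ha, hb]

/-- The lower corner of the cell of the grid `D` whose upper corner is `b`. -/
def cellLower (D : Finset unitInterval) (b : Cube κ) : Cube κ := fun j => predIn D (b j)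

-- In the product formula, the sum over cells factors into one telescoping sum per coordinate.
-- Degenerate cells, with a coordinate 0, contribute nothing.
open scoped Classical in
lemma sum_boxMass_cells (g : Cube κ → ℝ) {D : Finset unitInterval} (hD : 0 ∈ D) {y : Cube κ}
    (hy : ∀ j, y j ∈ D) :
    ∑ b ∈ (Fintype.piFinset fun _ => D).filter (· ≤ y), boxMass g (cellLower D b) b =
      boxMass g 0 y := by
  have hset : (Fintype.piFinset fun _ : κ => D).filter (· ≤ y) =
      Fintype.piFinset fun j => D.filter (· ≤ y j) := by
    ext b
    simp [Fintype.mem_piFinset, Pi.le_def, forall_and]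
  rw [hset, boxMass_eq_sum_grid g (D := D) (a := 0) (fun _ => hD) hy]
  have hcell : ∀ b ∈ Fintype.piFinset fun j => D.filter (· ≤ y j),
      boxMass g (cellLower D b) b = ∑ x ∈ Fintype.piFinset fun _ => D,
        (∏ j, ((if x j = b j then (1 : ℝ) else 0) -
          if x j = predIn D (b j) then 1 else 0)) * g x := fun b hb =>
    boxMass_eq_sum_grid g (fun j => predIn_mem hD _)
      fun j => (Finset.mem_filter.1 (Fintype.mem_piFinset.1 hb j)).1
  rw [Finset.sum_congr rfl hcell, Finset.sum_comm]
  refine Finset.sum_congr rfl fun x _ => ?_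
  rw [← Finset.sum_mul, ← Finset.prod_univ_sum (fun j => D.filter (· ≤ y j))
    fun j v => (if x j = v then (1 : ℝ) else 0) - if x j = predIn D v then 1 else 0]
  congr 1
  exact Finset.prod_congr rfl fun j _ =>
    sum_sub_predIn hD (fun v => if x j = v then (1 : ℝ) else 0) (hy j)

/-- Distinct cells are disjoint: where their upper corners differ, the smaller coordinate is at most
the predecessor of the larger. -/
lemma sum_abs_boxMass_cells_le (g : Cube κ → ℝ) (D : Finset unitInterval) :
    ∑ b ∈ Fintype.piFinset fun _ => D, ENNReal.ofReal |boxMass g (cellLower D b) b| ≤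
      totalVar g := by
  set F := (Fintype.piFinset fun _ : κ => D).image fun b => (cellLower D b, b) with hF
  have hsum : ∑ b ∈ Fintype.piFinset fun _ => D, ENNReal.ofReal |boxMass g (cellLower D b) b| =
      ∑ p ∈ F, ENNReal.ofReal |boxMass g p.1 p.2| := by
    rw [hF, Finset.sum_image fun b _ c _ h => (Prod.ext_iff.1 h).2]
  rw [hsum]
  refine le_iSup₂_of_le F (fun p hp => ?_) (le_iSup_of_le ?_ le_rfl)
  · obtain ⟨b, -, rfl⟩ := Finset.mem_image.1 hp
    exact fun j => predIn_le D (b j)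
  · intro p hp q hq hpq
    obtain ⟨b, hb, rfl⟩ := Finset.mem_image.1 (Finset.mem_coe.1 hp)
    obtain ⟨c, hc, rfl⟩ := Finset.mem_image.1 (Finset.mem_coe.1 hq)
    have hbc : b ≠ c := fun h => hpq (by rw [h])
    obtain ⟨j, hj⟩ := Function.ne_iff.1 hbc
    refine Set.disjoint_left.2 fun x hxb hxc => ?_
    have h1 := hxb j (mem_univ j)
    have h2 := hxc j (mem_univ j)
    rcases lt_or_gt_of_ne hj with h | h
    · exact absurd (h1.2.trans (le_predIn (Fintype.mem_piFinset.1 hb j) h)) (not_le.2 h2.1)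
    · exact absurd (h2.2.trans (le_predIn (Fintype.mem_piFinset.1 hc j) h)) (not_le.2 h1.1)

/-- The measure that puts, at the upper corner of each cell of the grid `D`, the positive part of
the mass of the cell. -/
def gridMeasure (g : Cube κ → ℝ) (D : Finset unitInterval) : Measure (Cube κ) :=
  ∑ b ∈ Fintype.piFinset fun _ => D,
    ENNReal.ofReal (boxMass g (cellLower D b) b) • Measure.dirac b

instance (g : Cube κ → ℝ) (D : Finset unitInterval) : IsFiniteMeasure (gridMeasure g D) := by
  unfold gridMeasure
  have (b : Cube κ) : IsFiniteMeasure
      (ENNReal.ofReal (boxMass g (cellLower D b) b) • Measure.dirac b) :=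
    Measure.smul_finite _ ENNReal.ofReal_ne_top
  infer_instance

lemma boxMass_neg (g : Cube κ → ℝ) (a b : Cube κ) : boxMass (-g) a b = -boxMass g a b := by
  simp [boxMass]

lemma gridMeasure_univ_add_le (g : Cube κ → ℝ) (D : Finset unitInterval) :
    gridMeasure g D univ + gridMeasure (-g) D univ ≤ totalVar g := by
  refine le_trans (le_of_eq ?_) (sum_abs_boxMass_cells_le g D)
  simp only [gridMeasure, Measure.coe_finsetSum, Finset.sum_apply, Measure.smul_apply,
    measure_univ, smul_eq_mul, mul_one, ← Finset.sum_add_distrib, boxMass_neg]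
  refine Finset.sum_congr rfl fun b _ => ?_
  rcases le_total 0 (boxMass g (cellLower D b) b) with h | h
  · rw [ENNReal.ofReal_of_nonpos (neg_nonpos.2 h), add_zero, abs_of_nonneg h]
  · rw [ENNReal.ofReal_of_nonpos h, zero_add, abs_of_nonpos h]

open scoped Classical in
lemma gridMeasure_real_Iic (g : Cube κ → ℝ) (D : Finset unitInterval) (y : Cube κ) :
    (gridMeasure g D).real (Iic y) =
      ∑ b ∈ (Fintype.piFinset fun _ => D).filter (· ≤ y),
        max (boxMass g (cellLower D b) b) 0 := by
  rw [Measure.real, gridMeasure, Measure.coe_finsetSum, Finset.sum_apply, ENNReal.toReal_sum,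
    Finset.sum_filter]
  · refine Finset.sum_congr rfl fun b _ => ?_
    rw [Measure.smul_apply, Measure.dirac_apply' _ measurableSet_Iic]
    by_cases h : b ≤ y <;> simp [h, ENNReal.toReal_ofReal']
  · intro b _
    rw [Measure.smul_apply, Measure.dirac_apply' _ measurableSet_Iic]
    by_cases h : b ≤ y <;> simp [h]

lemma gridMeasure_real_Iic_sub (g : Cube κ → ℝ) {D : Finset unitInterval} (hD : 0 ∈ D)
    {y : Cube κ} (hy : ∀ j, y j ∈ D) :
    (gridMeasure g D).real (Iic y) - (gridMeasure (-g) D).real (Iic y) = boxMass g 0 y := by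
  rw [gridMeasure_real_Iic, gridMeasure_real_Iic, ← Finset.sum_sub_distrib,
    ← sum_boxMass_cells g hD hy]
  refine Finset.sum_congr rfl fun b _ => ?_
  rw [boxMass_neg]
  exact max_zero_sub_max_neg_zero_eq_self _


lemma boxMass_eq_zero (g : Cube κ → ℝ) {a b : Cube κ} {j : κ} (h : a j = b j) :
    boxMass g a b = 0 := by
  rw [boxMass_eq_sum_grid g (D := Finset.univ.image a ∪ Finset.univ.image b) (by simp) (by simp)]
  exact Finset.sum_eq_zero fun x _ => by
    rw [Finset.prod_eq_zero (Finset.mem_univ j) (by rw [h, sub_self]), zero_mul]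

end Grid

/-! ### Weak limits and distribution functions -/

section WeakLimit

/-- Under weak convergence of finite measures, the measure of a closed set converges if the
boundary of the set is null for the limit. -/
lemma tendsto_real_of_null_frontier {Ω ι : Type*} [MeasurableSpace Ω] [TopologicalSpace Ω]
    [HasOuterApproxClosed Ω] [OpensMeasurableSpace Ω] {l : Filter ι} [l.NeBot]
    {μ : FiniteMeasure Ω} {μs : ι → FiniteMeasure Ω} (h : Tendsto μs l (𝓝 μ)) {E : Set Ω}
    (hE : IsClosed E) (hfr : (μ : Measure Ω) (frontier E) = 0) :
    Tendsto (fun i => (μs i : Measure Ω).real E) l (𝓝 ((μ : Measure Ω).real E)) := by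
  have upper (F : Set Ω) (hF : IsClosed F) {ε : ℝ} (hε : 0 < ε) :
      ∀ᶠ i in l, (μs i : Measure Ω).real F < (μ : Measure Ω).real F + ε := by
    have hlt : (l.limsup fun i => (μs i : Measure Ω) F) <
        (μ : Measure Ω) F + ENNReal.ofReal ε :=
      (FiniteMeasure.limsup_measure_closed_le_of_tendsto h hF).trans_lt
        (ENNReal.lt_add_right (measure_ne_top _ _) (by simpa using hε))
    filter_upwards [eventually_lt_of_limsup_lt hlt] with i hi
    have := (ENNReal.toReal_lt_toReal (measure_ne_top _ _)
      (ENNReal.add_ne_top.2 ⟨measure_ne_top _ _, ENNReal.ofReal_ne_top⟩)).2 hi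
    rwa [ENNReal.toReal_add (measure_ne_top _ _) ENNReal.ofReal_ne_top,
      ENNReal.toReal_ofReal hε.le] at this
  have hmass : Tendsto (fun i => (μs i : Measure Ω).real univ) l
      (𝓝 ((μ : Measure Ω).real univ)) :=
    (NNReal.tendsto_coe.2 h.mass)
  -- The lower bound comes from the upper bound for the closed set `(interior E)ᶜ`, whose limit mass
  -- is that of `Eᶜ`, together with convergence of total mass.
  have hint : (μ : Measure Ω).real (interior E)ᶜ =
      (μ : Measure Ω).real univ - (μ : Measure Ω).real E := by
    rw [measureReal_compl isOpen_interior.measurableSet]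
    congr 1
    refine measureReal_congr (LE.le.eventuallyLE interior_subset |>.antisymm ?_)
    rw [ae_le_set, ← hE.frontier_eq]
    exact hfr
  rw [Metric.tendsto_nhds]
  intro ε hε
  filter_upwards [upper E hE hε, upper _ isOpen_interior.isClosed_compl (half_pos hε),
    hmass.eventually (lt_mem_nhds (sub_lt_self _ (half_pos hε)))] with i h1 h2 h3
  have h4 : (μs i : Measure Ω).real univ - (μs i : Measure Ω).real E ≤
      (μs i : Measure Ω).real (interior E)ᶜ := by
    rw [measureReal_compl isOpen_interior.measurableSet]
    exact sub_le_sub_left (measureReal_mono interior_subset) _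
  rw [Real.dist_eq, abs_lt]
  constructor <;> linarith

variable {κ : Type} [Fintype κ]

/-- A coordinate with `y j = 1` imposes no constraint within the cube, so it creates no boundary. -/
lemma frontier_Iic_subset (y : Cube κ) :
    frontier (Iic y) ⊆ ⋃ j, {x : Cube κ | x j = y j ∧ y j ≠ 1} := by
  intro x hx
  by_contra hcon
  simp only [mem_iUnion, mem_ofPred_eq, not_exists, not_and, not_not] at hcon
  have hxy : x ≤ y := by simpa using isClosed_Iic.frontier_subset hx
  refine hx.2 (mem_interior.2 ⟨⋂ j, {z : Cube κ | z j < y j ∨ y j = 1}, fun z hz j => ?_,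
    isOpen_iInter_of_finite fun j => ?_, mem_iInter.2 fun j => ?_⟩)
  · rcases mem_iInter.1 hz j with h | h
    · exact h.le
    · exact h ▸ unitInterval.le_one'
  · by_cases h : y j = 1
    · simp [h]
    · simpa [h] using isOpen_lt (continuous_apply j) continuous_const
  · rcases eq_or_lt_of_le (hxy j) with h | h
    · exact Or.inr (hcon j h)
    · exact Or.inl h

/-- Distribution functions are right-continuous. -/
lemma continuousWithinAt_real_Iic (μ : Measure (Cube κ)) [IsFiniteMeasure μ] (y : Cube κ) :
    ContinuousWithinAt (fun z => μ.real (Iic z)) (Ici y) y := by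
  refine (ENNReal.tendsto_toReal (measure_ne_top _ _)).comp
    (tendsto_measure_of_tendsto_indicator_of_isFiniteMeasure _ μ
      (fun _ => measurableSet_Iic) fun x => ?_)
  by_cases hx : x ≤ y
  · filter_upwards [self_mem_nhdsWithin] with z hz
    exact iff_of_true (hx.trans hz) hx
  · have : ∀ᶠ z in 𝓝 y, z ∈ {z : Cube κ | x ≤ z}ᶜ := (isClosed_Ici (a := x)).isOpen_compl.mem_nhds hx
    filter_upwards [mem_nhdsWithin_of_mem_nhds this] with z hz
    exact iff_of_false hz hx

lemma mem_closure_Ici_inter_compl {S : Set unitInterval} (hS : S.Countable) {u : unitInterval}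
    (hu : u < 1) : u ∈ closure (Ici u ∩ Sᶜ) := by
  rw [mem_closure_iff_frequently]
  refine Frequently.filter_mono (f := 𝓝[>] u) ?_ nhdsWithin_le_nhds
  rw [(nhdsGT_basis_of_exists_gt ⟨1, hu⟩).frequently_iff]
  intro v hv
  obtain ⟨r, hr, h1, h2⟩ := ((hS.image Subtype.val).dense_compl ℝ).exists_between
    (Subtype.coe_lt_coe.2 hv)
  refine ⟨⟨r, u.2.1.trans h1.le, h2.le.trans v.2.2⟩, ⟨h1, h2⟩, le_of_lt h1, fun h => hr ⟨_, h, rfl⟩⟩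

/-- Lower orthants form a π-system generating the product σ-algebra, and the one at 1 is the whole
cube. -/
lemma measure_ext_of_Iic {μ ν : Measure (Cube κ)} [IsFiniteMeasure μ]
    (h : ∀ y, μ (Iic y) = ν (Iic y)) : μ = ν := by
  have htop : (Iic 1 : Set (Cube κ)) = univ :=
    eq_univ_of_forall fun x j => unitInterval.le_one'
  refine ext_of_generate_finite (range Iic) ?_ ?_ ?_ (htop ▸ h 1)
  · rw [← generateFrom_eq_pi (C := fun _ : κ => range (Iic : unitInterval → Set unitInterval))]
    · congr 1
      ext s
      constructor
      · rintro ⟨t, ht, rfl⟩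
        choose y hy using fun j => ht j (mem_univ j)
        exact ⟨y, by rw [← pi_univ_Iic]; simp [hy]⟩
      · rintro ⟨y, rfl⟩
        exact ⟨fun j => Iic (y j), fun j _ => ⟨y j, rfl⟩, pi_univ_Iic y⟩
    · intro _
      exact (borel_eq_generateFrom_Iic unitInterval).symm.trans
        (BorelSpace.measurable_eq (α := unitInterval)).symm
    · intro _
      exact ⟨fun _ => Iic 1, fun _ => ⟨1, rfl⟩,
        eq_univ_of_forall fun x => mem_iUnion.2 ⟨0, unitInterval.le_one'⟩⟩
  · rintro _ ⟨y, rfl⟩ _ ⟨z, rfl⟩ -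
    exact ⟨y ⊓ z, Iic_inter_Iic.symm⟩
  · rintro _ ⟨y, rfl⟩
    exact h y

end WeakLimit

/-! ### Jordan decomposition of a right-continuous function of finite variation -/

section JordanDecomposition

lemma box_zero_eq_inter {κ : Type} (y : Cube κ) : box 0 y = Iic y ∩ box 0 1 := by
  ext x
  simp only [box, mem_univ_pi, mem_inter_iff, mem_Iic, Pi.le_def, mem_Ioc, ← forall_and]
  exact forall_congr' fun j => ⟨fun h => ⟨h.2, h.1, unitInterval.le_one'⟩, fun h => ⟨h.2.1, h.1⟩⟩

lemma compl_box_zero_one {κ : Type} : (box 0 1 : Set (Cube κ))ᶜ = ⋃ j, {x | x j = 0} := by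
  ext x
  simp only [box, mem_compl_iff, mem_univ_pi, not_forall, mem_iUnion, mem_ofPred_eq]
  refine exists_congr fun j => ⟨fun h => ?_, fun h h' => ?_⟩
  · by_contra h0
    exact h ⟨lt_of_le_of_ne unitInterval.nonneg' (Ne.symm h0), unitInterval.le_one'⟩
  · exact h'.1.ne' h

variable {κ : Type} [Fintype κ]

lemma countable_marginal_atoms (μ : Measure (Cube κ)) [IsFiniteMeasure μ] (j : κ) :
    {v | 0 < μ {x | x j = v}}.Countable :=
  Measure.countable_meas_level_set_pos (measurable_pi_apply j)

lemma measurableSet_box (a b : Cube κ) : MeasurableSet (box a b) :=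
  MeasurableSet.univ_pi fun _ => measurableSet_Ioc

variable [DecidableEq κ]

lemma continuousWithinAt_boxMass {g : Cube κ → ℝ} (hg : ∀ x, ContinuousWithinAt g (Ici x) x)
    (y : Cube κ) : ContinuousWithinAt (boxMass g 0) (Ici y) y := by
  refine tendsto_finsetSum _ fun t _ => Tendsto.const_mul _ ?_
  refine (hg (t.piecewise 0 y)).tendsto.comp (tendsto_nhdsWithin_iff.2 ⟨?_, ?_⟩)
  · refine Continuous.continuousWithinAt (continuous_pi fun j => ?_)
    by_cases hj : j ∈ t
    · simpa [hj] using continuous_const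
    · simpa [hj] using continuous_apply j
  · filter_upwards [self_mem_nhdsWithin] with z hz j
    by_cases hj : j ∈ t <;> simp [hj, show y j ≤ z j from hz j]

/-- Finite measures whose difference has the distribution function `boxMass g 0` agree on the faces
`{x | x j = 0}` of the cube. -/
lemma restrict_compl_box_eq {g : Cube κ → ℝ} {μ ν : Measure (Cube κ)} [IsFiniteMeasure μ]
    [IsFiniteMeasure ν] (h : ∀ y, μ.real (Iic y) - ν.real (Iic y) = boxMass g 0 y) :
    μ.restrict (box 0 1)ᶜ = ν.restrict (box 0 1)ᶜ := by
  -- It suffices to treat each face separately. There `Iic y` cuts out the orthant below `y` with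
  -- its `j`-th coordinate set to 0, where `boxMass g 0` vanishes.
  rw [compl_box_zero_one, Measure.restrict_iUnion_congr]
  intro j
  refine measure_ext_of_Iic fun y => ?_
  have hset : Iic y ∩ {x | x j = 0} = Iic (Function.update y j 0) := by
    ext x
    simp only [mem_inter_iff, mem_Iic, mem_ofPred_eq, le_update_iff]
    constructor
    · rintro ⟨h1, h2⟩
      exact ⟨h2.le, fun k _ => h1 k⟩
    · rintro ⟨h1, h2⟩
      have h0 : x j = 0 := le_antisymm h1 unitInterval.nonneg'
      refine ⟨fun k => ?_, h0⟩
      by_cases hk : k = j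
      · rw [hk, h0]; exact unitInterval.nonneg'
      · exact h2 k hk
  rw [Measure.restrict_apply measurableSet_Iic, Measure.restrict_apply measurableSet_Iic, hset]
  have := h (Function.update y j 0)
  rw [boxMass_eq_zero g (j := j) (by simp), sub_eq_zero] at this
  exact (measureReal_eq_measureReal_iff).1 this

/-- A function on the cube of finite total variation is, up to its values on the coordinate faces
through `0`, the difference of the distribution functions of two measures. -/
lemma exists_measure_Iic_sub {g : Cube κ → ℝ} (hg : ∀ x, ContinuousWithinAt g (Ici x) x)
    (hV : totalVar g ≠ ∞) :
    ∃ μ ν : FiniteMeasure (Cube κ), (μ : Measure (Cube κ)) univ + (ν : Measure (Cube κ)) univ ≤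
      totalVar g ∧ ∀ y, (μ : Measure (Cube κ)).real (Iic y) - (ν : Measure (Cube κ)).real (Iic y) =
        boxMass g 0 y := by
  -- An ultrafilter makes both families of grid measures converge at once, without extracting
  -- subsequences.
  let U : Ultrafilter (Finset unitInterval) := Ultrafilter.of atTop
  let G (h : Cube κ → ℝ) (D : Finset unitInterval) : FiniteMeasure (Cube κ) :=
    ⟨gridMeasure h D, inferInstance⟩
  have hbound (D : Finset unitInterval) :
      (G g D : Measure (Cube κ)) univ + (G (-g) D : Measure (Cube κ)) univ ≤ totalVar g :=
    gridMeasure_univ_add_le g D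
  have hlim (h : Cube κ → ℝ) (hh : ∀ D, (G h D : Measure (Cube κ)) univ ≤ totalVar g) :
      ∃ μ, Tendsto (G h) U (𝓝 μ) := by
    obtain ⟨μ, -, hμ⟩ := (isCompact_setOfPred_finiteMeasure_le_of_compactSpace (Cube κ)
      (totalVar g).toNNReal).ultrafilter_le_nhds' (U.map (G h)) (Ultrafilter.mem_map.2 <| univ_mem' fun D => by
        change (G h D).mass ≤ _
        rw [← ENNReal.coe_le_coe, FiniteMeasure.ennreal_mass, ENNReal.coe_toNNReal hV]
        exact hh D)
    exact ⟨μ, hμ⟩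
  obtain ⟨μ, hμ⟩ := hlim g fun D => le_self_add.trans (hbound D)
  obtain ⟨ν, hν⟩ := hlim (-g) fun D => le_add_self.trans (hbound D)
  refine ⟨μ, ν, ?_, fun y => ?_⟩
  · have h1 : Tendsto (fun D => ((G g D).mass : ℝ≥0∞) + ((G (-g) D).mass : ℝ≥0∞)) U
        (𝓝 ((μ.mass : ℝ≥0∞) + (ν.mass : ℝ≥0∞))) :=
      (ENNReal.tendsto_coe.2 hμ.mass).add (ENNReal.tendsto_coe.2 hν.mass)
    simp only [FiniteMeasure.ennreal_mass] at h1
    exact le_of_tendsto h1 (Eventually.of_forall hbound)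
  let S (j : κ) : Set unitInterval :=
    {v | 0 < (μ : Measure (Cube κ)) {x | x j = v}} ∪ {v | 0 < (ν : Measure (Cube κ)) {x | x j = v}}
  have hS (j : κ) : (S j).Countable :=
    (countable_marginal_atoms _ j).union (countable_marginal_atoms _ j)
  -- Good points above `y`: their lower orthants have null frontier for both limits, and they
  -- accumulate at `y` because only countably many coordinates are excluded.
  let A : Set (Cube κ) := univ.pi fun j => Ici (y j) ∩ {v | v = 1 ∨ v ∉ S j}
  have hyA : y ∈ closure A := by
    rw [closure_pi_set]
    intro j _
    rcases eq_or_lt_of_le (unitInterval.le_one' : y j ≤ 1) with h | h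
    · exact subset_closure ⟨mem_Ici.2 le_rfl, Or.inl h⟩
    · exact closure_mono (inter_subset_inter_right _ fun v hv => Or.inr hv)
        (mem_closure_Ici_inter_compl (hS j) h)
  have hAy : A ⊆ Ici y := fun z hz j => (hz j (mem_univ j)).1
  have hA : ∀ z ∈ A, (μ : Measure (Cube κ)).real (Iic z) - (ν : Measure (Cube κ)).real (Iic z) =
      boxMass g 0 z := by
    intro z hz
    have hnull (ρ : FiniteMeasure (Cube κ)) (hρ : ∀ j, {v | 0 < (ρ : Measure (Cube κ))
        {x | x j = v}} ⊆ S j) : (ρ : Measure (Cube κ)) (frontier (Iic z)) = 0 := by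
      refine measure_mono_null (frontier_Iic_subset z) (measure_iUnion_null fun j => ?_)
      rcases (hz j (mem_univ j)).2 with h | h
      · simp [h]
      · refine measure_mono_null (fun x hx => hx.1) (t := {x | x j = z j}) ?_
        by_contra hne
        exact h (hρ j (pos_iff_ne_zero.2 hne))
    have h1 := (tendsto_real_of_null_frontier hμ isClosed_Iic
      (hnull μ fun j => subset_union_left)).sub
      (tendsto_real_of_null_frontier hν isClosed_Iic (hnull ν fun j => subset_union_right))
    refine tendsto_nhds_unique h1 (tendsto_const_nhds.congr' ?_)
    -- Once the grid contains 0 and the coordinates of `z`, the discrete identity at `z` is exact.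
    have hev : ∀ᶠ D in (U : Filter (Finset unitInterval)), insert 0 (Finset.univ.image z) ≤ D :=
      Ultrafilter.of_le _ (eventually_ge_atTop _)
    filter_upwards [hev] with D hD
    exact (gridMeasure_real_Iic_sub g (hD (Finset.mem_insert_self _ _)) fun j =>
      hD (Finset.mem_insert_of_mem (Finset.mem_image_of_mem z (Finset.mem_univ j)))).symm
  have := mem_closure_iff_nhdsWithin_neBot.1 hyA
  refine tendsto_nhds_unique (f := fun z => boxMass g 0 z) (l := 𝓝[A] y) ?_
    ((continuousWithinAt_boxMass hg y).mono hAy)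
  refine Tendsto.congr' ?_ (((continuousWithinAt_real_Iic (μ : Measure (Cube κ)) y).sub
    (continuousWithinAt_real_Iic (ν : Measure (Cube κ)) y)).mono hAy)
  filter_upwards [self_mem_nhdsWithin] with z hz using hA z hz

/-- The Jordan decomposition of the set function generated by a right-continuous function of finite
total variation. -/
lemma exists_jordan_decomposition {g : Cube κ → ℝ} (hg : ∀ x, ContinuousWithinAt g (Ici x) x)
    (hV : totalVar g ≠ ∞) :
    ∃ μ ν : Measure (Cube κ), IsFiniteMeasure μ ∧ IsFiniteMeasure ν ∧ μ (box 0 1)ᶜ = 0 ∧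
      ν (box 0 1)ᶜ = 0 ∧ μ univ + ν univ ≤ totalVar g ∧
      ∀ y, μ.real (Iic y) - ν.real (Iic y) = boxMass g 0 y := by
  obtain ⟨μ, ν, hle, h⟩ := exists_measure_Iic_sub hg hV
  refine ⟨(μ : Measure (Cube κ)).restrict (box 0 1), (ν : Measure (Cube κ)).restrict (box 0 1),
    inferInstance, inferInstance, ?_, ?_, ?_, fun y => ?_⟩
  · simp [Measure.restrict_apply (measurableSet_box 0 1).compl]
  · simp [Measure.restrict_apply (measurableSet_box 0 1).compl]
  · exact (add_le_add (Measure.restrict_le_self _) (Measure.restrict_le_self _)).trans hle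
  · have hfaces := congrArg (fun ρ => ρ.real (Iic y)) (restrict_compl_box_eq h)
    simp only [measureReal_restrict_apply measurableSet_Iic] at hfaces ⊢
    rw [← h y, ← measureReal_inter_add_sdiff (μ := (μ : Measure (Cube κ))) (s := Iic y)
      (measurableSet_box 0 1), ← measureReal_inter_add_sdiff (μ := (ν : Measure (Cube κ))) (s := Iic y)
      (measurableSet_box 0 1), sdiff_eq, hfaces]
    ring

end JordanDecomposition

/-! ### Expansion into sections and normalization of masses -/

section Representation

variable {d : ℕ}

lemma boxMass_sect_eq_sum_powerset (f : Cube (Fin d) → ℝ) (x : Cube (Fin d))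
    (s : Finset (Fin d)) :
    boxMass (sect f s) 0 (s.restrict x) =
      ∑ t ∈ s.powerset, (-1 : ℝ) ^ t.card * f ((s \ t).piecewise x 0) := by
  refine Finset.sum_bij' (fun t _ => t.map (Function.Embedding.subtype (· ∈ s)))
    (fun t _ => t.subtype (· ∈ s)) (fun t _ => ?_) (fun _ _ => Finset.mem_univ _) (fun t _ => ?_)
    (fun t ht => ?_) (fun t _ => ?_)
  · rw [Finset.mem_powerset]
    intro j hj
    obtain ⟨k, -, rfl⟩ := Finset.mem_map.1 hj
    exact k.2
  · ext k
    simp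
  · exact Finset.subtype_map_of_mem fun j hj => Finset.mem_powerset.1 ht hj
  · rw [Finset.card_map, sect]
    congr 2
    ext1 j
    by_cases hs : j ∈ s
    · by_cases ht : (⟨j, hs⟩ : s) ∈ t <;>
        simp [extendZero, hs, ht, Finset.piecewise]
    · simp [extendZero, hs, Finset.piecewise]

/-- Möbius inversion: grouping by `u = s \ t` leaves an alternating sum over the subsets of `uᶜ`,
which vanishes unless `u` is everything. -/
lemma sum_sum_powerset_eq_univ {α : Type*} [Fintype α] [DecidableEq α] (F : Finset α → ℝ) :
    ∑ s : Finset α, ∑ t ∈ s.powerset, (-1 : ℝ) ^ t.card * F (s \ t) = F Finset.univ := by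
  have hswap : ∑ s : Finset α, ∑ t ∈ s.powerset, (-1 : ℝ) ^ t.card * F (s \ t) =
      ∑ u : Finset α, ∑ t ∈ uᶜ.powerset, (-1 : ℝ) ^ t.card * F u := by
    rw [Finset.sum_sigma', Finset.sum_sigma']
    refine Finset.sum_nbij' (fun p => ⟨p.1 \ p.2, p.2⟩) (fun p => ⟨p.1 ∪ p.2, p.2⟩) ?_ ?_ ?_ ?_ ?_
    · rintro ⟨s, t⟩ h
      simp only [Finset.mem_sigma, Finset.mem_univ, Finset.mem_powerset, true_and] at h ⊢
      intro j hj
      simp [hj]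
    · rintro ⟨u, t⟩ -
      simpa only [Finset.mem_sigma, Finset.mem_univ, Finset.mem_powerset, true_and] using
        Finset.subset_union_right
    · rintro ⟨s, t⟩ h
      simp only [Finset.mem_sigma, Finset.mem_univ, Finset.mem_powerset, true_and] at h
      simp [Finset.sdiff_union_of_subset h]
    · rintro ⟨u, t⟩ h
      simp only [Finset.mem_sigma, Finset.mem_univ, Finset.mem_powerset, true_and] at h
      have hd : Disjoint u t := Finset.disjoint_left.2 fun j hu ht =>
        Finset.mem_compl.1 (h ht) hu
      simp [Finset.union_sdiff_cancel_right hd]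
    · rintro ⟨s, t⟩ -
      rfl
  rw [hswap, Finset.sum_eq_single Finset.univ]
  · simp
  · intro u _ hu
    rw [← Finset.sum_mul]
    have := Finset.sum_powerset_neg_one_pow_card_of_nonempty (x := uᶜ)
      (by rwa [Finset.nonempty_iff_ne_empty, Ne, Finset.compl_eq_empty_iff])
    have h : ∑ t ∈ uᶜ.powerset, (-1 : ℝ) ^ t.card = 0 := by exact_mod_cast this
    rw [h, zero_mul]
  · simp

/-- A function on the cube is the sum of the increments of its sections. -/
lemma eq_add_sum_boxMass_sect (f : Cube (Fin d) → ℝ) (x : Cube (Fin d)) :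
    f x = f 0 + ∑ s : NonemptySubset d, boxMass (sect f s.1) 0 (s.1.restrict x) := by
  have h := sum_sum_powerset_eq_univ fun u : Finset (Fin d) => f (u.piecewise x 0)
  simp only [← boxMass_sect_eq_sum_powerset, Finset.piecewise_univ] at h
  rw [← h, ← Finset.add_sum_erase _ _ (Finset.mem_univ ∅)]
  congr 1
  · rw [boxMass_sect_eq_sum_powerset]
    simp only [Finset.powerset_empty, Finset.sum_singleton, Finset.card_empty, pow_zero, one_mul]
    exact congrArg f (funext fun j => Finset.piecewise_eq_of_notMem _ _ _ (by simp))
  · exact Finset.sum_subtype _ (fun s => by simp [Finset.nonempty_iff_ne_empty])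
      fun s => boxMass (sect f s) 0 (s.restrict x)

lemma IsCadlag.continuousWithinAt_sect {f : Cube (Fin d) → ℝ} (hf : IsCadlag f)
    (s : Finset (Fin d)) (y : Cube s) : ContinuousWithinAt (sect f s) (Ici y) y := by
  refine (hf (extendZero s y)).1.tendsto.comp (tendsto_nhdsWithin_iff.2 ⟨?_, ?_⟩)
  · refine Continuous.continuousWithinAt (continuous_pi fun j => ?_)
    by_cases hj : j ∈ s
    · simpa [extendZero, hj] using continuous_apply (⟨j, hj⟩ : s)
    · simpa [extendZero, hj] using continuous_const
  · filter_upwards [self_mem_nhdsWithin] with z hz j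
    by_cases hj : j ∈ s
    · simpa [extendZero, hj] using hz ⟨j, hj⟩
    · simp [extendZero, hj]

lemma measure_compl_box_dirac_one {κ : Type} [Fintype κ] :
    Measure.dirac (1 : Cube κ) (box 0 1)ᶜ = 0 := by
  rw [Measure.dirac_apply' _ (measurableSet_box 0 1).compl, indicator_of_notMem]
  simp [box]

/-- A finite measure concentrated on `(0, 1]` is a multiple of a probability measure concentrated
on `(0, 1]`. -/
lemma exists_probability_smul {κ : Type} [Fintype κ] (μ : Measure (Cube κ)) [IsFiniteMeasure μ]
    (h : μ (box 0 1)ᶜ = 0) :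
    ∃ P : Measure (Cube κ), IsProbabilityMeasure P ∧ P (box 0 1)ᶜ = 0 ∧ μ = μ univ • P := by
  by_cases h0 : μ = 0
  · exact ⟨Measure.dirac 1, inferInstance, measure_compl_box_dirac_one, by simp [h0]⟩
  · have hu : μ univ ≠ 0 := by simpa using h0
    have : NeZero μ := ⟨h0⟩
    refine ⟨(μ univ)⁻¹ • μ, inferInstance, by simp [h], ?_⟩
    rw [smul_smul, ENNReal.mul_inv_cancel hu (measure_ne_top _ _), one_smul]

/-- The sections of a càdlàg function `f` with `‖f‖_v ≤ M` are differences of distribution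
functions of measures on `(0, 1]` of total mass exactly `M - |f 0|`. -/
lemma exists_measures_sections (hd : 1 ≤ d) {M : ℝ} (hM : 0 ≤ M) {f : Cube (Fin d) → ℝ}
    (hf : IsCadlag f) (hfM : sectionalVariationNorm f ≤ ENNReal.ofReal M) :
    ∃ m : (s : NonemptySubset d) → Fin 2 → Measure (Cube s.1),
      (∀ s i, IsFiniteMeasure (m s i)) ∧ (∀ s i, m s i (box 0 1)ᶜ = 0) ∧
      (∑ p : NonemptySubset d × Fin 2, (m p.1 p.2).real univ = M - |f 0|) ∧
      ∀ s y, (m s 0).real (Iic y) - (m s 1).real (Iic y) = boxMass (sect f s.1) 0 y := by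
  have hsum : ∑ s : NonemptySubset d, totalVar (sect f s.1) ≠ ∞ :=
    ne_top_of_le_ne_top ENNReal.ofReal_ne_top (le_add_self.trans hfM)
  have hV (s : NonemptySubset d) : totalVar (sect f s.1) ≠ ∞ :=
    ENNReal.sum_ne_top.1 hsum s (Finset.mem_univ s)
  choose μ ν hμ hν hμ0 hν0 hle hcdf using fun s : NonemptySubset d =>
    exists_jordan_decomposition (fun y => hf.continuousWithinAt_sect s.1 y) (hV s)
  have htotal : ∑ s : NonemptySubset d, ((μ s).real univ + (ν s).real univ) ≤ M - |f 0| := by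
    have h1 : ENNReal.ofReal |f 0| + ∑ s : NonemptySubset d, (μ s univ + ν s univ) ≤
        ENNReal.ofReal M :=
      (add_le_add_right (Finset.sum_le_sum fun s _ => hle s) _).trans hfM
    have h2 := ENNReal.toReal_mono ENNReal.ofReal_ne_top h1
    have hfin (s : NonemptySubset d) : μ s univ + ν s univ ≠ ∞ :=
      ENNReal.add_ne_top.2 ⟨measure_ne_top _ _, measure_ne_top _ _⟩
    rw [ENNReal.toReal_add ENNReal.ofReal_ne_top (ENNReal.sum_ne_top.2 fun s _ => hfin s),
      ENNReal.toReal_sum fun s _ => hfin s, ENNReal.toReal_ofReal hM,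
      ENNReal.toReal_ofReal (abs_nonneg _)] at h2
    simp only [ENNReal.toReal_add (measure_ne_top _ _) (measure_ne_top _ _)] at h2
    simp only [Measure.real]
    linarith
  -- Half of the missing mass goes to each of the two measures of `s₀`, as the same point mass at 1,
  -- so it cancels in their difference.
  set r := (M - |f 0| - ∑ s : NonemptySubset d, ((μ s).real univ + (ν s).real univ)) / 2 with hr
  have hr0 : 0 ≤ r := by linarith
  let s₀ : NonemptySubset d := ⟨Finset.univ, ⟨⟨0, hd⟩, Finset.mem_univ _⟩⟩
  let slack (s : NonemptySubset d) : Measure (Cube s.1) :=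
    ENNReal.ofReal (if s = s₀ then r else 0) • Measure.dirac 1
  have hslack (s : NonemptySubset d) : IsFiniteMeasure (slack s) :=
    Measure.smul_finite _ ENNReal.ofReal_ne_top
  have hslack_univ (s : NonemptySubset d) : (slack s).real univ = if s = s₀ then r else 0 := by
    simp only [slack, measureReal_ennreal_smul_apply, probReal_univ, mul_one]
    exact ENNReal.toReal_ofReal (by split_ifs <;> simp [hr0])
  have hslack_box (s : NonemptySubset d) : slack s (box 0 1)ᶜ = 0 := by
    rw [Measure.smul_apply, measure_compl_box_dirac_one, smul_zero]
  have hμadd (s : NonemptySubset d) (A : Set (Cube s.1)) :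
      (μ s + slack s).real A = (μ s).real A + (slack s).real A := measureReal_add_apply
  have hνadd (s : NonemptySubset d) (A : Set (Cube s.1)) :
      (ν s + slack s).real A = (ν s).real A + (slack s).real A := measureReal_add_apply
  refine ⟨fun s => ![μ s + slack s, ν s + slack s], fun s i => ?_, fun s i => ?_, ?_, fun s y => ?_⟩
  · fin_cases i
    · exact inferInstanceAs (IsFiniteMeasure (μ s + slack s))
    · exact inferInstanceAs (IsFiniteMeasure (ν s + slack s))
  · fin_cases i <;> simp [hμ0, hν0, hslack_box]
  · rw [Fintype.sum_prod_type]
    simp only [Fin.sum_univ_two, Matrix.cons_val_zero, Matrix.cons_val_one, hμadd, hνadd,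
      hslack_univ]
    have (s : NonemptySubset d) : (μ s).real univ + (if s = s₀ then r else 0) +
        ((ν s).real univ + if s = s₀ then r else 0) =
        ((μ s).real univ + (ν s).real univ) + if s = s₀ then 2 * r else 0 := by
      split_ifs <;> ring
    simp only [this, Finset.sum_add_distrib, Finset.sum_ite_eq', Finset.mem_univ, if_true] at hr ⊢
    linarith
  · simp only [Matrix.cons_val_zero, Matrix.cons_val_one, hμadd, hνadd]
    rw [← hcdf s y]
    ring

end Representation

end SectionalVariation

end

theorem mainTheorem4 (d : ℕ) (hd : 1 ≤ d) (M : ℝ) (hM : 0 ≤ M)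
    (f : SectionalVariation.Cube (Fin d) → ℝ)
    (hf : SectionalVariation.IsCadlag f)
    (hfM : SectionalVariation.sectionalVariationNorm f ≤ ENNReal.ofReal M) :
    ∃ α ∈ stdSimplex ℝ (SectionalVariation.NonemptySubset d × Fin 2),
    ∃ (g : (s : SectionalVariation.NonemptySubset d) → Fin 2 → SectionalVariation.Cube s.1 → ℝ)
      (P : (s : SectionalVariation.NonemptySubset d) → Fin 2 →
        Measure (SectionalVariation.Cube s.1)),
      (∀ s i, SectionalVariation.IsCDFOf (P s i) (g s i)) ∧
      (∀ s i, P s i (SectionalVariation.box 0 1) = 1) ∧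
      (∀ x : SectionalVariation.Cube (Fin d),
        f x = f 0 + (M - |f 0|) * ∑ s : SectionalVariation.NonemptySubset d,
          ((∫ _ in SectionalVariation.box 0 (s.1.restrict x), α (s, 0) ∂(P s 0))
            - ∫ _ in SectionalVariation.box 0 (s.1.restrict x), α (s, 1) ∂(P s 1))) ∧
      (∀ x : SectionalVariation.Cube (Fin d),
        f x = f 0 + (M - |f 0|) * ∑ s : SectionalVariation.NonemptySubset d,
          (α (s, 0) * g s 0 (s.1.restrict x) - α (s, 1) * g s 1 (s.1.restrict x))) := by
  obtain ⟨m, hmfin, hm0, hmsum, hm⟩ :=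
    SectionalVariation.exists_measures_sections hd hM hf hfM
  choose P hP hP0 hmP using fun s i => SectionalVariation.exists_probability_smul (m s i) (hm0 s i)
  have hPbox (s : SectionalVariation.NonemptySubset d) (i : Fin 2) (y) :
      (P s i).real (SectionalVariation.box 0 y) = (P s i).real (Iic y) := by
    rw [SectionalVariation.box_zero_eq_inter]
    exact measureReal_congr (inter_ae_eq_left_of_ae_eq_univ (ae_eq_univ.2 (hP0 s i)))
  have hcM : 0 ≤ M - |f 0| := hmsum ▸ Finset.sum_nonneg fun p _ => measureReal_nonneg
  obtain ⟨α, hα, hαm⟩ : ∃ α ∈ stdSimplex ℝ (SectionalVariation.NonemptySubset d × Fin 2),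
      ∀ s i, (M - |f 0|) * α (s, i) = (m s i).real univ := by
    -- If `M = |f 0|`, all the masses vanish and any point of the simplex serves; otherwise the
    -- weights are the normalized masses.
    rcases hcM.eq_or_lt with h | h
    · let s₀ : SectionalVariation.NonemptySubset d :=
        ⟨Finset.univ, ⟨⟨0, hd⟩, Finset.mem_univ _⟩⟩
      refine ⟨_, single_mem_stdSimplex ℝ (s₀, 0), fun s i => ?_⟩
      rw [← h, zero_mul]
      exact ((Finset.sum_eq_zero_iff_of_nonneg fun p _ => measureReal_nonneg).1
        (hmsum.trans h.symm) (s, i) (Finset.mem_univ _)).symm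
    · refine ⟨fun p => (m p.1 p.2).real univ / (M - |f 0|),
        ⟨fun p => div_nonneg measureReal_nonneg hcM, ?_⟩, fun s i => mul_div_cancel₀ _ h.ne'⟩
      rw [← Finset.sum_div, hmsum, div_self h.ne']
  have hmain (x : SectionalVariation.Cube (Fin d)) :
      f x = f 0 + (M - |f 0|) * ∑ s : SectionalVariation.NonemptySubset d,
        (α (s, 0) * (P s 0).real (Iic (s.1.restrict x)) -
          α (s, 1) * (P s 1).real (Iic (s.1.restrict x))) := by
    have hreal (s : SectionalVariation.NonemptySubset d) (i : Fin 2) (A) :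
        (m s i).real A = (m s i).real univ * (P s i).real A := by
      conv_lhs => rw [hmP s i]
      exact measureReal_ennreal_smul_apply ..
    rw [SectionalVariation.eq_add_sum_boxMass_sect f x, Finset.mul_sum]
    congr 1
    refine Finset.sum_congr rfl fun s _ => ?_
    rw [← hm s, hreal s 0, hreal s 1, ← hαm, ← hαm]
    ring
  refine ⟨α, hα, fun s i y => (P s i).real (Iic y), P, fun s i => ⟨hP s i, fun _ => rfl⟩,
    fun s i => ?_, fun x => ?_, hmain⟩
  · have := hP s i
    exact (prob_compl_eq_zero_iff (SectionalVariation.measurableSet_box 0 1)).1 (hP0 s i)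
  · simp only [setIntegral_const, smul_eq_mul, hPbox, mul_comm _ (α _)]
    exact hmain x
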